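/- **Theorem 1.2.** Conventions: a simplicial complex is an abstract simplicial complex, and $H_k(X;G)$ denotes simplicial homology with coefficients in an abelian group $G$. A complex is *pure $d$-dimensional* if each of its simplices is contained in a $d$-dimensional face; it is a *strongly connected $d$-dimensional complex* if it is pure $d$-dimensional and any two of its $d$-dimensional faces can be joined by a finite sequence of $d$-dimensional faces in which consecutive ones share a $(d-1)$-dimensional face. Let $1\le k\le d$ be integers. (1) For every abelian group $G$, every strongly connected $d$-dimensional simplicial complex $X$ with $H_k(X;G)\neq 0$ has at least $$d+1+\left\lceil \frac dk\right\rceil=\left\lceil\frac{d(k+1)}{k}+1\right\rceil$$ vertices. (2) This bound is tight. Let $V=\{v_1,\dots,v_d\}$ and $W=\{w_1,\dots,w_{\lceil d/k\rceil+1}\}$ be disjoint sets, and divide $V$ into $k$ disjoint sets $S_i=\{v_l : l\equiv i \pmod k\}$, $1\le i\le k$ (so that $|S_i|=\lceil d/k\rceil$ for $i\le d \bmod k$ and $|S_i|=\lfloor d/k\rfloor$ for the other $i$). Let $MS_{d,k}$ be the complex on $V\cup W$ whose faces are the nonempty subsets of the following sets: $W\cup\bigcup_{i\ne j}S_i$ for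 $1\le j\le k$; $(V\cup W)\setminus\{w_1\}$; and $V\cup\{w_1\}$. Then the $d$-skeleton of $MS_{d,k}$ is a strongly connected $d$-dimensional complex with exactly $d+1+\lceil d/k\rceil$ vertices, and its $k$-th homology with coefficients in any nonzero abelian group is nonzero. -/

import Mathlib

/-!
Simplicial complexes are Mathlib's `PreAbstractSimplicialComplex V`: a family of nonempty finite
subsets of `V` (the faces) closed under taking nonempty subsets.  A face with `n + 1` elements has
dimension `n`.  The complex may be infinite, and not every element of `V` has to be a vertex of it.
-/

namespace PreAbstractSimplicialComplex

universe u v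

section Combinatorics

variable {V : Type u}

/-- The vertices of `K`: the points `x` such that `{x}` is a face. -/
def vertices (K : PreAbstractSimplicialComplex V) : Set V := {x | {x} ∈ K.faces}

/-- The `n`-dimensional faces of `K`. -/
def facesOfDim (K : PreAbstractSimplicialComplex V) (n : ℕ) : Set (Finset V) :=
  {σ | σ ∈ K.faces ∧ σ.card = n + 1}

/-- `K` is pure `d`-dimensional: every face is contained in a `d`-dimensional face. -/
def IsPure (K : PreAbstractSimplicialComplex V) (d : ℕ) : Prop :=
  ∀ σ ∈ K.faces, ∃ τ ∈ K.facesOfDim d, σ ⊆ τ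

/-- Two `d`-dimensional faces of `K` share a `(d-1)`-dimensional face (a subset with `d` elements;
such a subset of a face is itself a face). -/
def ShareFace (K : PreAbstractSimplicialComplex V) (d : ℕ) (σ τ : Finset V) : Prop :=
  σ ∈ K.facesOfDim d ∧ τ ∈ K.facesOfDim d ∧ ∃ ρ : Finset V, ρ.card = d ∧ ρ ⊆ σ ∧ ρ ⊆ τ

/-- `K` is a strongly connected (pure) `d`-dimensional complex: it is pure `d`-dimensional and any
two of its `d`-dimensional faces are equivalent under the transitive closure of `ShareFace`. -/
def IsStronglyConnected (K : PreAbstractSimplicialComplex V) (d : ℕ) : Prop :=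
  K.IsPure d ∧
    ∀ σ ∈ K.facesOfDim d, ∀ τ ∈ K.facesOfDim d, Relation.TransGen (K.ShareFace d) σ τ

/-- The `n`-skeleton of `K`: the faces of dimension at most `n`. -/
def skeleton (K : PreAbstractSimplicialComplex V) (n : ℕ) : PreAbstractSimplicialComplex V where
  faces := {σ | σ ∈ K.faces ∧ σ.card ≤ n + 1}
  isRelLowerSet_faces := fun _ hσ =>
    ⟨(K.isRelLowerSet_faces hσ.1).1, fun _ hτ hne =>
      ⟨(K.isRelLowerSet_faces hσ.1).2 hτ hne, (Finset.card_le_card hτ).trans hσ.2⟩⟩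

end Combinatorics

/-!
Simplicial homology with coefficients in an abelian group `G`.  The vertices are linearly ordered,
which orients every simplex; as usual the homology groups do not depend on the order, up to
isomorphism.
-/

section Homology

variable {V : Type u} [LinearOrder V] (G : Type v) [AddCommGroup G]

/-- The boundary operator: for `σ = {x₀ < ⋯ < xₙ}` and `g : G`, the chain `g • σ` is sent to
`∑ i, (-1) ^ i • g • (σ \ {xᵢ})`. -/
noncomputable def boundary : (Finset V →₀ G) →ₗ[ℤ] (Finset V →₀ G) :=
  Finsupp.lsum ℤ fun σ : Finset V =>
    ∑ x ∈ σ, (-1 : ℤ) ^ (σ.filter (· < x)).card • Finsupp.lsingle (σ.erase x)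

/-- The boundary of a boundary is zero. -/
theorem boundary_boundary (c : Finset V →₀ G) : boundary G (boundary G c) = 0 := by
  have key : (boundary (V := V) G) ∘ₗ (boundary G) = 0 := by
    refine Finsupp.lhom_ext fun σ g => ?_
    simp only [boundary, LinearMap.comp_apply, Finsupp.lsum_single, LinearMap.sum_apply,
      LinearMap.smul_apply, Finsupp.lsingle_apply, map_sum, map_smul, LinearMap.zero_apply,
      Finset.smul_sum, smul_smul, ← pow_add]
    rw [Finset.sum_sigma']
    refine Finset.sum_involution (fun p _ => ⟨p.2, p.1⟩) ?_ ?_ ?_ ?_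
    · rintro ⟨x, y⟩ h
      simp only [Finset.mem_sigma, Finset.mem_erase] at h
      obtain ⟨hx, hyx, hy⟩ := h
      have aux : ∀ a b : V, a ∈ σ → a < b → (σ.filter (· < b)).card
          = ((σ.erase a).filter (· < b)).card + 1 := by
        intro a b ha hab
        rw [Finset.filter_erase, Finset.card_erase_add_one (by simp [ha, hab])]
      have aux2 : ∀ a b : V, a < b → ((σ.erase b).filter (· < a)) = σ.filter (· < a) := by
        intro a b hab
        rw [Finset.filter_erase, Finset.erase_eq_of_notMem (by simp [hab.le])]
      simp only [Finset.erase_right_comm (a := y) (b := x)]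
      rw [← add_smul]
      rcases lt_or_gt_of_ne hyx with h | h
      · rw [aux2 y x h, aux y x hy h]; ring_nf; simp
      · rw [aux2 x y h, aux x y hx h]; ring_nf; simp
    · rintro ⟨x, y⟩ h _ he
      simp only [Finset.mem_sigma, Finset.mem_erase] at h
      simp only [Sigma.mk.injEq] at he
      exact h.2.1 he.1
    · rintro ⟨x, y⟩ h
      simp only [Finset.mem_sigma, Finset.mem_erase] at h ⊢
      exact ⟨h.2.2, h.2.1.symm, h.1⟩
    · intros; rfl
  exact LinearMap.congr_fun key c

variable (K : PreAbstractSimplicialComplex V) (n : ℕ)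

/-- The simplicial `n`-chains of `K`: finite formal sums of `n`-dimensional faces of `K` with
coefficients in `G`. -/
def chains : Submodule ℤ (Finset V →₀ G) := Finsupp.supported G ℤ (K.facesOfDim n)

/-- The simplicial `n`-cycles of `K`: the `n`-chains with zero boundary; every `0`-chain is a
cycle (this is unreduced homology). -/
noncomputable def cycles : Submodule ℤ (Finset V →₀ G) :=
  if n = 0 then K.chains G n else K.chains G n ⊓ LinearMap.ker (boundary G)

/-- The simplicial `n`-boundaries of `K`: the boundaries of `(n+1)`-chains. -/
noncomputable def boundaries : Submodule ℤ (Finset V →₀ G) :=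
  (K.chains G (n + 1)).map (boundary G)

/-- Every `n`-boundary is an `n`-cycle. -/
theorem boundaries_le_cycles : K.boundaries G n ≤ K.cycles G n := by
  rintro _ ⟨c, hc, rfl⟩
  have h1 : boundary G c ∈ K.chains G n := by
    simp only [boundary, Finsupp.lsum_apply, Finsupp.sum, LinearMap.sum_apply,
      LinearMap.smul_apply, Finsupp.lsingle_apply]
    refine Submodule.sum_mem _ fun σ hσ => Submodule.sum_mem _ fun x hx =>
      Submodule.smul_mem _ _ (Finsupp.single_mem_supported ℤ _ ?_)
    obtain ⟨hK, hcard⟩ : σ ∈ K.facesOfDim (n + 1) := hc hσ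
    have hcard' : (σ.erase x).card = n + 1 := by rw [Finset.card_erase_of_mem hx, hcard]; rfl
    exact ⟨(K.isRelLowerSet_faces hK).2 (Finset.erase_subset x σ)
      (Finset.card_pos.1 (by omega)), hcard'⟩
  unfold cycles
  split_ifs
  · exact h1
  · exact ⟨h1, boundary_boundary G c⟩

/-- The simplicial homology group `H_n(K; G)`, cycles modulo boundaries. -/
abbrev homology : Type (max u v) := K.cycles G n ⧸ (K.boundaries G n).submoduleOf (K.cycles G n)

end Homology

end PreAbstractSimplicialComplex

/-!
The complex `MS_{d,k}`.  Its vertices are the `d + 1 + ⌈d/k⌉` elements of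
`Fin (d + 1 + ⌈d/k⌉)`: those with value `< d` are `v₁, …, v_d`, the one with value `d` is `w₁`, and
those with value `> d` are `w₂, …, w_{⌈d/k⌉+1}`.
-/

namespace MS

/-- The number of vertices, `d + 1 + ⌈d/k⌉`. -/
def size (d k : ℕ) : ℕ := d + 1 + ⌈(d : ℚ) / (k : ℚ)⌉₊

/-- `V = {v₁, …, v_d}`. -/
def V (d k : ℕ) : Finset (Fin (size d k)) := Finset.univ.filter fun x => (x : ℕ) < d

/-- `W = {w₁, …, w_{⌈d/k⌉+1}}`, the complement of `V`. -/
def W (d k : ℕ) : Finset (Fin (size d k)) := Finset.univ.filter fun x => d ≤ (x : ℕ)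

/-- The vertex `w₁`. -/
def w₁ (d k : ℕ) : Fin (size d k) := ⟨d, by unfold size; omega⟩

/-- The parts `S_0, …, S_{k-1}` of `V`: the residue classes modulo `k`.  The first `d % k` of them
have `⌈d/k⌉` elements and the other ones `⌊d/k⌋`. -/
def S (d k : ℕ) (i : Fin k) : Finset (Fin (size d k)) :=
  (V d k).filter fun x => (x : ℕ) % k = (i : ℕ)

/-- `MS_{d,k}`: the complex generated by the simplices `W ∪ ⋃_{i ≠ j} S_i` for all `j`, the simplex
`(V ∪ W) \ {w₁}` and the simplex `V ∪ {w₁}`. -/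
def complex (d k : ℕ) : PreAbstractSimplicialComplex (Fin (size d k)) where
  faces := {σ | σ.Nonempty ∧
    ((∃ j : Fin k, σ ⊆ W d k ∪ (Finset.univ.filter (· ≠ j)).biUnion (S d k)) ∨
      σ ⊆ (V d k ∪ W d k).erase (w₁ d k) ∨
      σ ⊆ insert (w₁ d k) (V d k))}
  isRelLowerSet_faces := fun _ hσ =>
    ⟨hσ.1, fun _ hτ hne => ⟨hne, hσ.2.imp (fun ⟨j, h⟩ => ⟨j, hτ.trans h⟩)
      (Or.imp hτ.trans hτ.trans)⟩⟩

end MS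

/-! Lower bound. Suppose `X` has fewer vertices than claimed; let `E` be its vertex set and `m = |E|
- (d + 1)`, so that `m * k < d`. Strong connectivity puts finitely many `d`-faces, enough to carry a
given `k`-cycle, on one walk in which consecutive faces share `d` vertices. Each face of the walk
omits `m` vertices of `E`, and two consecutive ones jointly omit at most `m + 1`. Such a union of
simplices has vanishing reduced `k`-th homology (`exists_boundary_eq_of_isChain`): attach the
simplices one at a time by Mayer–Vietoris. The new simplex `F` meets the earlier union in a union of
simplices inside `E ∩ F`, which loses at most `m` vertices while the degree drops by one. In degree
zero, consecutive simplices have a common vertex. So the cycle bounds inside `X`.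

Tightness. Color the parts `S_i`, the vertex `w₁` and the rest of `W` with `k + 2` colors. Then
`MS_{d,k}` consists of the nonempty sets that miss a color (`mem_faces_iff`): it is the preimage of
the boundary of a `(k+1)`-simplex under the coloring. A transversal of the colors has its boundary
in the complex, and a determinant cocycle pulled back along the coloring takes the values `± g` on
it and zero on boundaries. No color class exceeds `⌈d/k⌉` vertices, so every maximal face has at
least `d + 1`, and `isStronglyConnected_skeleton` applies. -/

namespace PreAbstractSimplicialComplex

universe u v

/-! ### Cones, Mayer–Vietoris, and vanishing homology of unions of large simplices. -/

section Acyclicity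

variable {V : Type u} {G : Type v} [AddCommGroup G]

/-- The sets with `j` elements contained in `E` and in a member of `L`. -/
def coveredSubsets (E : Finset V) (L : List (Finset V)) (j : ℕ) : Set (Finset V) :=
  {σ | σ.card = j ∧ σ ⊆ E ∧ ∃ F ∈ L, σ ⊆ F}

theorem supported_coveredSubsets_mono {E E' : Finset V} {L L' : List (Finset V)} {j : ℕ}
    (hE : E ⊆ E') (hL : L ⊆ L') :
    Finsupp.supported G ℤ (coveredSubsets E L j) ≤ Finsupp.supported G ℤ (coveredSubsets E' L' j) :=
  Finsupp.supported_mono fun _ ⟨hc, hs, F, hF, hF'⟩ => ⟨hc, hs.trans hE, F, hL hF, hF'⟩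

variable [LinearOrder V]

theorem boundary_single (σ : Finset V) (g : G) :
    boundary G (Finsupp.single σ g) =
      ∑ x ∈ σ, (-1 : ℤ) ^ (σ.filter (· < x)).card • Finsupp.single (σ.erase x) g := by
  simp [boundary]

theorem boundary_mem_supported {s t : Set (Finset V)}
    (hst : ∀ σ ∈ s, ∀ x ∈ σ, σ.erase x ∈ t) {c : Finset V →₀ G}
    (hc : c ∈ Finsupp.supported G ℤ s) : boundary G c ∈ Finsupp.supported G ℤ t := by
  rw [← Finsupp.sum_single c, Finsupp.sum, map_sum]
  refine Submodule.sum_mem _ fun σ hσ => ?_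
  rw [boundary_single]
  exact Submodule.sum_mem _ fun x hx => Submodule.smul_mem _ _
    (Finsupp.single_mem_supported ℤ _ (hst σ (hc hσ) x hx))

variable (G) in
/-- The cone operator with apex `x`, for chains all of whose vertices are at least `x`. -/
noncomputable def cone (x : V) : (Finset V →₀ G) →ₗ[ℤ] (Finset V →₀ G) :=
  Finsupp.lsum ℤ fun σ : Finset V => if x ∈ σ then 0 else Finsupp.lsingle (insert x σ)

theorem cone_single (x : V) (σ : Finset V) (g : G) :
    cone G x (Finsupp.single σ g) = if x ∈ σ then 0 else Finsupp.single (insert x σ) g := by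
  simp only [cone, Finsupp.lsum_single]
  split_ifs <;> rfl

/-- Since `x` is minimal, inserting it in front costs no sign and shifts every other position by
one, so the mixed terms cancel. If `x` already lies in `σ`, only the face opposite `x` survives the
cone. -/
theorem boundary_cone_add_cone_boundary_single {x : V} {σ : Finset V} (hx : ∀ y ∈ σ, x ≤ y)
    (g : G) :
    boundary G (cone G x (Finsupp.single σ g)) + cone G x (boundary G (Finsupp.single σ g)) =
      Finsupp.single σ g := by
  have hlt : σ.filter (· < x) = ∅ :=
    Finset.filter_eq_empty_iff.2 fun y hy => not_lt.2 (hx y hy)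
  rw [boundary_single, map_sum]
  simp only [map_smul, cone_single]
  by_cases h : x ∈ σ
  · rw [if_pos h, map_zero, zero_add, Finset.sum_eq_single x]
    · simp [hlt, Finset.insert_erase h]
    · intro y _ hyx
      rw [if_pos (Finset.mem_erase.2 ⟨hyx.symm, h⟩), smul_zero]
    · exact fun h' => absurd h h'
  · rw [if_neg h, boundary_single, Finset.sum_insert h, Finset.filter_insert, if_neg (lt_irrefl x),
      hlt, Finset.erase_insert h, add_assoc, ← Finset.sum_add_distrib, Finset.sum_eq_zero]
    · simp
    · intro y hy
      have hxy : x < y := lt_of_le_of_ne (hx y hy) fun e => h (e ▸ hy)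
      rw [Finset.filter_insert, if_pos hxy, Finset.card_insert_of_notMem (by simp [h]),
        if_neg (fun h' => h (Finset.mem_of_mem_erase h')),
        Finset.erase_insert_of_ne hxy.ne, pow_succ]
      simp

/-- A full simplex is contracted by coning from its least vertex. Here `j` counts vertices, and `j =
0` allows the empty simplex, so this is acyclicity of the augmented complex. -/
theorem exists_boundary_eq_of_simplex {A : Finset V} (hA : A.Nonempty) {j : ℕ}
    {z : Finset V →₀ G} (hz : z ∈ Finsupp.supported G ℤ {σ | σ.card = j ∧ σ ⊆ A})
    (hz0 : boundary G z = 0) :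
    ∃ c ∈ Finsupp.supported G ℤ {σ | σ.card = j + 1 ∧ σ ⊆ A}, boundary G c = z := by
  refine ⟨cone G (A.min' hA) z, ?_, ?_⟩
  · rw [← Finsupp.sum_single z, Finsupp.sum, map_sum]
    refine Submodule.sum_mem _ fun σ hσ => ?_
    obtain ⟨hc, hs⟩ := hz hσ
    rw [cone_single]
    split_ifs with h
    · exact Submodule.zero_mem _
    · exact Finsupp.single_mem_supported ℤ _ ⟨by rw [Finset.card_insert_of_notMem h, hc],
        Finset.insert_subset (Finset.min'_mem A hA) hs⟩
  · have key : boundary G (cone G (A.min' hA) z) + cone G (A.min' hA) (boundary G z) = z := by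
      conv_rhs => rw [← Finsupp.sum_single z, Finsupp.sum]
      conv_lhs => rw [← Finsupp.sum_single z, Finsupp.sum]
      simp only [map_sum, ← Finset.sum_add_distrib]
      refine Finset.sum_congr rfl fun σ hσ => ?_
      exact boundary_cone_add_cone_boundary_single
        (fun y hy => A.min'_le y ((hz hσ).2 hy)) _
    rwa [hz0, map_zero, add_zero] at key

theorem erase_mem_coveredSubsets {E : Finset V} {L : List (Finset V)} {j : ℕ} {σ : Finset V}
    (hσ : σ ∈ coveredSubsets E L (j + 1)) {x : V} (hx : x ∈ σ) :
    σ.erase x ∈ coveredSubsets E L j := by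
  obtain ⟨hc, hE, F, hF, hs⟩ := hσ
  refine ⟨?_, (Finset.erase_subset _ _).trans hE, F, hF, (Finset.erase_subset _ _).trans hs⟩
  rw [Finset.card_erase_of_mem hx, hc, Nat.add_sub_cancel]

/-- The step of the Mayer–Vietoris argument: adding one simplex to a union of simplices. -/
theorem exists_boundary_eq_cons {E F : Finset V} {L : List (Finset V)} {j : ℕ}
    (hEF : (E ∩ F).Nonempty)
    (hinter : ∀ z ∈ Finsupp.supported G ℤ (coveredSubsets (E ∩ F) L j), boundary G z = 0 →
      ∃ c ∈ Finsupp.supported G ℤ (coveredSubsets (E ∩ F) L (j + 1)), boundary G c = z)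
    (hL : ∀ z ∈ Finsupp.supported G ℤ (coveredSubsets E L (j + 1)), boundary G z = 0 →
      ∃ c ∈ Finsupp.supported G ℤ (coveredSubsets E L (j + 2)), boundary G c = z)
    {z : Finset V →₀ G} (hz : z ∈ Finsupp.supported G ℤ (coveredSubsets E (F :: L) (j + 1)))
    (hz0 : boundary G z = 0) :
    ∃ c ∈ Finsupp.supported G ℤ (coveredSubsets E (F :: L) (j + 2)), boundary G c = z := by
  classical
  -- The part of `z` in `F` and the rest, which lies in `L`, have opposite boundaries; these lie in
  -- the intersection.
  set a := z.filter (· ⊆ F) with ha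
  set b := z.filter (fun σ => ¬ σ ⊆ F) with hb
  have hab : a + b = z := Finsupp.filter_add_filter_not z _
  have ham : a ∈ Finsupp.supported G ℤ {σ | σ.card = j + 1 ∧ σ ⊆ E ∩ F} := by
    intro σ hσ
    rw [ha, Finsupp.support_filter, Finset.coe_filter] at hσ
    obtain ⟨hc, hs, -⟩ := hz hσ.1
    exact ⟨hc, Finset.subset_inter hs hσ.2⟩
  have hbm : b ∈ Finsupp.supported G ℤ (coveredSubsets E L (j + 1)) := by
    intro σ hσ
    rw [hb, Finsupp.support_filter, Finset.coe_filter] at hσ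
    obtain ⟨hc, hs, F', hF', hs'⟩ := hz hσ.1
    rcases List.mem_cons.1 hF' with rfl | h
    · exact absurd hs' hσ.2
    · exact ⟨hc, hs, F', h, hs'⟩
  have hdab : boundary G a = -boundary G b := by
    rw [← add_eq_zero_iff_eq_neg, ← map_add, hab, hz0]
  have hda : boundary G a ∈ Finsupp.supported G ℤ (coveredSubsets (E ∩ F) L j) := by
    have h1 : boundary G a ∈ Finsupp.supported G ℤ {σ | σ.card = j ∧ σ ⊆ E ∩ F} := by
      refine boundary_mem_supported ?_ ham
      rintro σ ⟨hc, hs⟩ x hx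
      exact ⟨by rw [Finset.card_erase_of_mem hx, hc, Nat.add_sub_cancel],
        (Finset.erase_subset _ _).trans hs⟩
    have h2 : boundary G a ∈ Finsupp.supported G ℤ (coveredSubsets E L j) := by
      rw [hdab]
      exact Submodule.neg_mem _
        (boundary_mem_supported (fun σ hσ x hx => erase_mem_coveredSubsets hσ hx) hbm)
    intro σ hσ
    obtain ⟨hc, -, hF⟩ := h2 hσ
    exact ⟨hc, (h1 hσ).2, hF⟩
  -- Filling `∂a` by `c` in the intersection turns `z` into a sum of two cycles: `a - c` in the
  -- simplex `E ∩ F` and `b + c` in the union of `L`.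
  obtain ⟨c, hc, hca⟩ := hinter _ hda (boundary_boundary G a)
  obtain ⟨p, hp, hpa⟩ : ∃ p ∈ Finsupp.supported G ℤ {σ | σ.card = j + 1 + 1 ∧ σ ⊆ E ∩ F},
      boundary G p = a - c := by
    refine exists_boundary_eq_of_simplex hEF (Submodule.sub_mem _ ham ?_) ?_
    · exact Finsupp.supported_mono (by exact fun σ hσ => ⟨hσ.1, hσ.2.1⟩) hc
    · rw [map_sub, hca, sub_self]
  obtain ⟨q, hq, hqb⟩ := hL (b + c)
    (Submodule.add_mem _ hbm
      (supported_coveredSubsets_mono Finset.inter_subset_left (List.Subset.refl L) hc))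
    (by rw [map_add, hca, hdab, add_neg_cancel])
  refine ⟨p + q, Submodule.add_mem _ ?_ ?_, ?_⟩
  · exact Finsupp.supported_mono (by exact fun σ hσ => ⟨hσ.1, hσ.2.trans Finset.inter_subset_left,
      F, List.mem_cons_self, hσ.2.trans Finset.inter_subset_right⟩) hp
  · exact supported_coveredSubsets_mono (Finset.Subset.refl E) (List.subset_cons_self F L) hq
  · rw [map_add, hpa, hqb, ← hab]
    abel

/-- A union of simplices has vanishing reduced homology in degree `j` if the simplices are so
large that any `j + 1` of them meet, and so do any `j + 2` of them two of which are consecutive. -/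
theorem exists_boundary_eq_of_isChain (m j : ℕ) :
    ∀ (L : List (Finset V)) (E : Finset V), (j + 1) * m + 2 ≤ E.card →
      (∀ F ∈ L, (E \ F).card ≤ m) →
      L.IsChain (fun F F' => (E \ (F ∩ F')).card ≤ m + 1) →
      ∀ z ∈ Finsupp.supported G ℤ (coveredSubsets E L (j + 1)), boundary G z = 0 →
        ∃ c ∈ Finsupp.supported G ℤ (coveredSubsets E L (j + 2)), boundary G c = z := by
  induction j with
  | zero =>
    intro L
    induction L with
    | nil =>
      intro E _ _ _ z hz _
      have : z = 0 := by
        simpa [coveredSubsets] using hz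
      exact ⟨0, Submodule.zero_mem _, by rw [this, map_zero]⟩
    | cons F L ih =>
      intro E hE hF hch z hz hz0
      have hEF : (E ∩ F).Nonempty := by
        rw [← Finset.card_pos]
        have h1 := hF F List.mem_cons_self
        have h2 := Finset.card_sdiff_add_card_inter E F
        omega
      -- A lone simplex is a cone; otherwise the next simplex `F'` supplies a vertex common with
      -- `F`.
      rcases L with _ | ⟨F', L⟩
      · have hz' : z ∈ Finsupp.supported G ℤ {σ | σ.card = 0 + 1 ∧ σ ⊆ E ∩ F} :=
          Finsupp.supported_mono (by exact fun σ ⟨hc, hs, F', hF', hs'⟩ => ⟨hc, Finset.subset_inter hs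
            (by rwa [List.mem_singleton.1 hF'] at hs')⟩) hz
        obtain ⟨c, hc, rfl⟩ := exists_boundary_eq_of_simplex hEF hz' hz0
        exact ⟨c, Finsupp.supported_mono (by exact fun σ hσ => ⟨hσ.1, hσ.2.trans Finset.inter_subset_left,
          F, List.mem_cons_self, hσ.2.trans Finset.inter_subset_right⟩) hc, rfl⟩
      · rw [List.isChain_cons_cons] at hch
        refine exists_boundary_eq_cons hEF ?_ ?_ hz hz0
        · intro y hy _
          -- The only use of consecutiveness: `F` and `F'` jointly omit at most `m + 1` of the at
          -- least `m + 2` elements of `E`. The common vertex then fills the chain `y`, a multiple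
          -- of the empty simplex.
          have hEFF : (E ∩ (F ∩ F')).Nonempty := by
            rw [← Finset.card_pos]
            have h2 := Finset.card_sdiff_add_card_inter E (F ∩ F')
            omega
          obtain ⟨x, hx⟩ := hEFF
          simp only [Finset.mem_inter] at hx
          refine ⟨Finsupp.single {x} (y ∅), Finsupp.single_mem_supported ℤ _
            ⟨Finset.card_singleton x, ?_, F', List.mem_cons_self, ?_⟩, ?_⟩
          · simp [hx]
          · simp [hx]
          · rw [boundary_single, Finset.sum_singleton]
            have : y = Finsupp.single ∅ (y ∅) := by
              ext σ
              by_cases h : σ = ∅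
              · simp [h]
              · rw [Finsupp.single_eq_of_ne h]
                by_contra h'
                exact h (Finset.card_eq_zero.1 (hy (Finsupp.mem_support_iff.2 h')).1)
            conv_rhs => rw [this]
            simp [Finset.filter_singleton]
        · exact ih E hE (fun F'' h => hF F'' (List.mem_cons_of_mem _ h)) hch.2
  | succ j ihj =>
    intro L
    induction L with
    | nil =>
      intro E _ _ _ z hz _
      have : z = 0 := by
        simpa [coveredSubsets] using hz
      exact ⟨0, Submodule.zero_mem _, by rw [this, map_zero]⟩
    | cons F L ih =>
      intro E hE hF hch z hz hz0
      have h1 := hF F List.mem_cons_self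
      have h2 := Finset.card_sdiff_add_card_inter E F
      -- Passing to `E ∩ F` loses at most `m` vertices, exactly what lowering the degree by one
      -- permits.
      have hcard : (j + 1) * m + 2 ≤ (E ∩ F).card := by
        have : (j + 1 + 1) * m = (j + 1) * m + m := by ring
        omega
      have hEF : (E ∩ F).Nonempty := Finset.card_pos.1 (by omega)
      have hmono : ∀ A : Finset V, ((E ∩ F) \ A).card ≤ (E \ A).card := fun A =>
        Finset.card_le_card (Finset.sdiff_subset_sdiff Finset.inter_subset_left subset_rfl)
      have hF' : ∀ F' ∈ L, (E \ F').card ≤ m := fun F' h => hF F' (List.mem_cons_of_mem _ h)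
      have hch' := hch.tail
      refine exists_boundary_eq_cons hEF ?_ ?_ hz hz0
      · exact ihj L (E ∩ F) hcard (fun F' h => (hmono F').trans (hF' F' h))
          (hch'.imp fun A B h => (hmono _).trans h)
      · exact ih E hE hF' hch'

end Acyclicity

/-! ### Walks through facets and the lower bound. -/

section LowerBound

variable {V : Type u}

/-- Prepends a path to a walk. The clause `∃ y, R x y` is carried along because, for `ShareFace`, it
certifies that every entry is a `d`-face, even in a one-element list. -/
theorem exists_isChain_cons_of_transGen {R : V → V → Prop} {a b : V} (h : Relation.TransGen R b a)
    (L : List V) (hL : (a :: L).IsChain R) (hR : ∀ x ∈ a :: L, ∃ y, R x y) :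
    ∃ L' : List V, (b :: L').IsChain R ∧ (∀ x ∈ b :: L', ∃ y, R x y) ∧ a :: L ⊆ L' := by
  induction h using Relation.TransGen.head_induction_on with
  | single h =>
    exact ⟨a :: L, List.isChain_cons_cons.2 ⟨h, hL⟩, List.forall_mem_cons.2 ⟨⟨_, h⟩, hR⟩,
      List.Subset.refl _⟩
  | head h _ ih =>
    obtain ⟨L', h1, h2, h3⟩ := ih
    exact ⟨_ :: L', List.isChain_cons_cons.2 ⟨h, h1⟩, List.forall_mem_cons.2 ⟨⟨_, h⟩, h2⟩,
      List.subset_cons_of_subset _ h3⟩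

/-- Finitely many elements that are pairwise joined by paths lie on one walk. -/
theorem exists_isChain_of_transGen {R : V → V → Prop} (s : Finset V)
    (hs : ∀ a ∈ s, ∀ b ∈ s, Relation.TransGen R a b) :
    ∃ L : List V, L.IsChain R ∧ (∀ x ∈ L, ∃ y, R x y) ∧ ∀ a ∈ s, a ∈ L := by
  classical
  -- Keeping the head of the walk in `s` guarantees a path from the next element to it.
  suffices H : ∃ L : List V, L.IsChain R ∧ (∀ x ∈ L, ∃ y, R x y) ∧ (∀ a ∈ s, a ∈ L) ∧
      ∀ a ∈ L.head?, a ∈ s from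
    H.imp fun _ h => ⟨h.1, h.2.1, h.2.2.1⟩
  induction s using Finset.induction_on with
  | empty => exact ⟨[], by simp⟩
  | insert b s _ ih =>
    obtain ⟨L, h1, hR, h2, h3⟩ := ih fun x hx y hy =>
      hs x (Finset.mem_insert_of_mem hx) y (Finset.mem_insert_of_mem hy)
    rcases L with _ | ⟨a, L⟩
    · have hb := hs b (Finset.mem_insert_self _ _) b (Finset.mem_insert_self _ _)
      refine ⟨[b], by simp, ?_, ?_, by simp⟩
      · intro x hx
        obtain ⟨y, hy, -⟩ := Relation.TransGen.head'_iff.1 hb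
        exact ⟨y, by rwa [List.mem_singleton.1 hx]⟩
      intro x hx
      rcases Finset.mem_insert.1 hx with rfl | hx
      · simp
      · simpa using h2 x hx
    · have ha : a ∈ s := h3 a (by simp)
      obtain ⟨L', h4, h5, h6⟩ := exists_isChain_cons_of_transGen
        (hs b (Finset.mem_insert_self _ _) a (Finset.mem_insert_of_mem ha)) L h1 hR
      refine ⟨b :: L', h4, h5, ?_, by simp⟩
      intro x hx
      rcases Finset.mem_insert.1 hx with rfl | hx
      · simp
      · exact List.mem_cons_of_mem _ (h6 (h2 x hx))

variable [LinearOrder V] {G : Type v} [AddCommGroup G]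

theorem lower_bound {d k : ℕ} (hk : 1 ≤ k) (X : PreAbstractSimplicialComplex V)
    (hX : X.IsStronglyConnected d) (hH : Nontrivial (X.homology G k)) :
    ((d + 1 + ⌈(d : ℚ) / k⌉₊ : ℕ) : ℕ∞) ≤ X.vertices.encard := by
  by_contra! hlt
  have hfin : X.vertices.Finite := Set.finite_of_encard_le_coe hlt.le
  set E := hfin.toFinset with hE
  rw [hfin.encard_eq_coe_toFinset_card, Nat.cast_lt, ← hE] at hlt
  have hsub : ∀ σ ∈ X.faces, σ ⊆ E := by
    intro σ hσ x hx
    rw [hE, Set.Finite.mem_toFinset]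
    exact (X.isRelLowerSet_faces hσ).2 (Finset.singleton_subset_iff.2 hx)
      (Finset.singleton_nonempty x)
  refine not_subsingleton (X.homology G k) ?_
  rw [Submodule.Quotient.subsingleton_iff, Submodule.submoduleOf_eq_top]
  intro z hz
  rw [cycles, if_neg (by omega)] at hz
  obtain ⟨hz, hz0⟩ := hz
  -- A nonzero cycle provides a `d`-face, hence `d + 1 ≤ E.card`, so the subtraction `E.card - (d +
  -- 1)` is not truncated.
  rcases eq_or_ne z 0 with rfl | hne
  · exact Submodule.zero_mem _
  classical
  have hpure : ∀ σ ∈ z.support, ∃ τ ∈ X.facesOfDim d, σ ⊆ τ := fun σ hσ => hX.1 σ (hz hσ).1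
  choose! f hf hf' using hpure
  obtain ⟨L, hL, hLX, hzL⟩ := exists_isChain_of_transGen (R := X.ShareFace d)
    (z.support.image f) (by
      intro a ha b hb
      rw [Finset.mem_image] at ha hb
      obtain ⟨σ, hσ, rfl⟩ := ha
      obtain ⟨τ, hτ, rfl⟩ := hb
      exact hX.2 _ (hf σ hσ) _ (hf τ hτ))
  obtain ⟨σ₀, hσ₀⟩ := Finsupp.support_nonempty_iff.2 hne
  have hdE : d + 1 ≤ E.card := by
    rw [← (hf σ₀ hσ₀).2]
    exact Finset.card_le_card (hsub _ (hf σ₀ hσ₀).1)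
  have hm : (E.card - (d + 1)) * k < d := by
    have h1 : E.card - (d + 1) < ⌈(d : ℚ) / k⌉₊ := by omega
    rw [Nat.lt_ceil, lt_div_iff₀ (by exact_mod_cast hk)] at h1
    exact_mod_cast h1
  -- With `m = E.card - (d + 1)`, the requirement `(k + 1) * m + 2 ≤ E.card` is the inequality `m *
  -- k < d`.
  obtain ⟨c, hc, hcz⟩ := exists_boundary_eq_of_isChain (E.card - (d + 1)) k L E
    (by rw [add_mul, mul_comm k]; omega)
    (by
      intro F hF
      obtain ⟨F', hFX, -⟩ := hLX F hF
      rw [Finset.card_sdiff_of_subset (hsub F hFX.1), hFX.2])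
    (hL.imp fun F F' ⟨hF, _, ρ, hρ, hρF, hρF'⟩ => by
      have h1 : ρ ⊆ F ∩ F' := Finset.subset_inter hρF hρF'
      have h2 := Finset.card_le_card (Finset.sdiff_subset_sdiff (Finset.Subset.refl E) h1)
      rw [Finset.card_sdiff_of_subset (hρF.trans (hsub F hF.1)), hρ] at h2
      omega)
    z (fun σ hσ => ⟨(hz hσ).2, hsub σ (hz hσ).1, f σ, hzL _ (Finset.mem_image_of_mem f hσ),
      hf' σ hσ⟩) hz0
  refine ⟨c, fun σ hσ => ?_, hcz⟩
  obtain ⟨hcard, -, F, hF, hs⟩ := hc hσ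
  obtain ⟨F', hFX, -⟩ := hLX F hF
  exact ⟨(X.isRelLowerSet_faces hFX.1).2 hs (Finset.card_pos.1 (by omega)), hcard⟩

end LowerBound

end PreAbstractSimplicialComplex

namespace PreAbstractSimplicialComplex

universe u v

/-! ### A criterion for strongly connected skeleta. -/

section StrongConnectivity

variable {V : Type u} [DecidableEq V] {Y : PreAbstractSimplicialComplex V} {d : ℕ}

/-- Exchange one vertex of `σ \ τ` for one of `τ \ σ` at a time, by induction on `(σ \ τ).card`. -/
theorem transGen_shareFace_of_simplex {A : Finset V}
    (hA : ∀ σ ⊆ A, σ.card = d + 1 → σ ∈ Y.faces) (σ τ : Finset V) (hσ : σ ⊆ A)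
    (hσc : σ.card = d + 1) (hτ : τ ⊆ A) (hτc : τ.card = d + 1) :
    Relation.TransGen (Y.ShareFace d) σ τ := by
  induction hn : (σ \ τ).card generalizing σ with
  | zero =>
    have hστ : σ = τ :=
      Finset.eq_of_subset_of_card_le (Finset.sdiff_eq_empty_iff_subset.1 (Finset.card_eq_zero.1 hn))
        (by omega)
    subst hστ
    -- `TransGen` needs at least one step, and a face shares any of its `d`-element subsets with
    -- itself.
    obtain ⟨ρ, h1, h2⟩ := Finset.exists_subset_card_eq (s := σ) (n := d) (by omega)
    exact .single ⟨⟨hA σ hσ hσc, hσc⟩, ⟨hA σ hσ hσc, hσc⟩, ρ, h2, h1, h1⟩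
  | succ n ih =>
    obtain ⟨x, hx⟩ : (σ \ τ).Nonempty := Finset.card_pos.1 (by omega)
    obtain ⟨y, hy⟩ : (τ \ σ).Nonempty := by
      rw [← Finset.card_pos, ← Finset.card_sdiff_comm (hσc.trans hτc.symm)]
      omega
    rw [Finset.mem_sdiff] at hx hy
    have hyx : y ∉ σ.erase x := fun h => hy.2 (Finset.mem_of_mem_erase h)
    have hcard : (σ.erase x).card = d := by
      rw [Finset.card_erase_of_mem hx.1, hσc, Nat.add_sub_cancel]
    have hc' : (insert y (σ.erase x)).card = d + 1 := by
      rw [Finset.card_insert_of_notMem hyx, hcard]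
    have hs' : insert y (σ.erase x) ⊆ A :=
      Finset.insert_subset (hτ hy.1) ((Finset.erase_subset _ _).trans hσ)
    refine .head ⟨⟨hA σ hσ hσc, hσc⟩, ⟨hA _ hs' hc', hc'⟩, σ.erase x, hcard,
      Finset.erase_subset _ _, Finset.subset_insert _ _⟩ (ih _ hs' hc' ?_)
    rw [Finset.insert_sdiff_of_mem _ hy.1, Finset.erase_sdiff_comm,
      Finset.card_erase_of_mem (Finset.mem_sdiff.2 hx), hn, Nat.add_sub_cancel]

/-- A complex generated by simplices that all meet one of them in at least `d` vertices has a
strongly connected `d`-skeleton. -/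
theorem isStronglyConnected_skeleton {K : PreAbstractSimplicialComplex V} {B : Finset V}
    (hB : ∀ σ ⊆ B, σ.Nonempty → σ ∈ K.faces) (hBc : d + 1 ≤ B.card)
    (hK : ∀ σ ∈ K.faces, ∃ A : Finset V, σ ⊆ A ∧ (∀ τ ⊆ A, τ.Nonempty → τ ∈ K.faces) ∧
      d + 1 ≤ A.card ∧ d ≤ (A ∩ B).card) :
    (K.skeleton d).IsStronglyConnected d := by
  have hskel : ∀ A : Finset V, (∀ τ ⊆ A, τ.Nonempty → τ ∈ K.faces) →
      ∀ σ ⊆ A, σ.card = d + 1 → σ ∈ (K.skeleton d).faces := fun A hA σ hσ hc =>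
    ⟨hA σ hσ (Finset.card_pos.1 (by omega)), hc.le⟩
  have : Std.Symm ((K.skeleton d).ShareFace d) := ⟨fun σ τ ⟨h1, h2, ρ, h3, h4, h5⟩ =>
    ⟨h2, h1, ρ, h3, h5, h4⟩⟩
  -- Choose `d` common vertices `ρ` of `A` and `B`; move inside `A` to a face containing `ρ`, then
  -- cross over `ρ` into `B`.
  have hcenter : ∀ σ ∈ (K.skeleton d).facesOfDim d, ∃ β ⊆ B, β.card = d + 1 ∧
      Relation.TransGen ((K.skeleton d).ShareFace d) σ β := by
    rintro σ ⟨⟨hσ, -⟩, hσc⟩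
    obtain ⟨A, hσA, hA, hAc, hAB⟩ := hK σ hσ
    obtain ⟨ρ, hρ, hρc⟩ := Finset.exists_subset_card_eq hAB
    obtain ⟨hρA, hρB⟩ := Finset.subset_inter_iff.1 hρ
    obtain ⟨α, hρα, hαA, hαc⟩ := Finset.exists_subsuperset_card_eq hρA (n := d + 1) (by omega) hAc
    obtain ⟨β, hρβ, hβB, hβc⟩ := Finset.exists_subsuperset_card_eq hρB (n := d + 1) (by omega) hBc
    exact ⟨β, hβB, hβc,
      (transGen_shareFace_of_simplex (hskel A hA) σ α hσA hσc hαA hαc).tail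
        ⟨⟨hskel A hA α hαA hαc, hαc⟩, ⟨hskel B hB β hβB hβc, hβc⟩, ρ, hρc, hρα, hρβ⟩⟩
  refine ⟨fun σ hσ => ?_, fun σ hσ τ hτ => ?_⟩
  · obtain ⟨A, hσA, hA, hAc, -⟩ := hK σ hσ.1
    obtain ⟨α, hσα, hαA, hαc⟩ := Finset.exists_subsuperset_card_eq hσA (n := d + 1) hσ.2 hAc
    exact ⟨α, ⟨hskel A hA α hαA hαc, hαc⟩, hσα⟩
  · obtain ⟨β, hβB, hβc, hβ⟩ := hcenter σ hσ
    obtain ⟨γ, hγB, hγc, hγ⟩ := hcenter τ hτ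
    exact (hβ.trans (transGen_shareFace_of_simplex (hskel B hB) β γ hβB hβc hγB hγc)).trans
      (Std.Symm.symm _ _ hγ)

end StrongConnectivity

/-! ### Determinant cochains that detect homology. -/

section Cochain

variable {V : Type u} [LinearOrder V]

theorem card_filter_lt_orderEmbOfFin {τ : Finset V} {n : ℕ} (h : τ.card = n) (i : Fin n) :
    (τ.filter (· < τ.orderEmbOfFin h i)).card = i := by
  have : τ.filter (· < τ.orderEmbOfFin h i) =
      (Finset.Iio i).map (τ.orderEmbOfFin h).toEmbedding := by
    ext x
    simp only [Finset.mem_filter, Finset.mem_map, Finset.mem_Iio, RelEmbedding.coe_toEmbedding]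
    constructor
    · rintro ⟨hx, hlt⟩
      rw [← Finset.mem_coe, ← Finset.range_orderEmbOfFin τ h] at hx
      obtain ⟨j, rfl⟩ := hx
      exact ⟨j, (OrderEmbedding.lt_iff_lt _).1 hlt, rfl⟩
    · rintro ⟨j, hj, rfl⟩
      exact ⟨Finset.orderEmbOfFin_mem τ h j, (OrderEmbedding.lt_iff_lt _).2 hj⟩
  rw [this, Finset.card_map, Fin.card_Iio]

theorem orderEmbOfFin_erase {τ : Finset V} {n : ℕ} (h : τ.card = n + 1) (i : Fin (n + 1))
    (h' : (τ.erase (τ.orderEmbOfFin h i)).card = n) (j : Fin n) :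
    (τ.erase (τ.orderEmbOfFin h i)).orderEmbOfFin h' j = τ.orderEmbOfFin h (i.succAbove j) := by
  refine (congr_fun (Finset.orderEmbOfFin_unique h'
    (f := fun j => τ.orderEmbOfFin h (i.succAbove j)) (fun j => ?_) ?_) j).symm
  · exact Finset.mem_erase.2 ⟨fun e => Fin.succAbove_ne i j ((τ.orderEmbOfFin h).injective e),
      Finset.orderEmbOfFin_mem τ h _⟩
  · exact (τ.orderEmbOfFin h).strictMono.comp (Fin.strictMono_succAbove i)

variable (G : Type v) [AddCommGroup G] {n : ℕ} (f : Fin n → V → ℤ)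

/-- The cochain `{x₁ < ⋯ < xₙ} ↦ det (f j xᵢ)`, the product of the functions `f j`. -/
noncomputable def detCochain : (Finset V →₀ G) →ₗ[ℤ] G :=
  Finsupp.lsum ℤ fun σ : Finset V =>
    if h : σ.card = n then
      (Matrix.of fun i j => f j (σ.orderEmbOfFin h i)).det • LinearMap.id
    else 0

variable {G}

theorem detCochain_single {σ : Finset V} (h : σ.card = n) (g : G) :
    detCochain G f (Finsupp.single σ g) =
      (Matrix.of fun i j => f j (σ.orderEmbOfFin h i)).det • g := by
  simp only [detCochain, Finsupp.lsum_single, dif_pos h]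
  rfl

/-- The coboundary of `detCochain` is given by the determinants bordered by a column of ones. -/
theorem detCochain_boundary_single {τ : Finset V} (h : τ.card = n + 1) (g : G) :
    detCochain G f (boundary G (Finsupp.single τ g)) =
      (Matrix.of fun i : Fin (n + 1) =>
        (Fin.cons 1 fun j => f j (τ.orderEmbOfFin h i) : Fin (n + 1) → ℤ)).det • g := by
  rw [boundary_single, map_sum]
  conv_lhs => rw [← Finset.map_orderEmbOfFin_univ τ h]
  -- The alternating sum over the faces of `τ` is the Laplace expansion along the column of ones.
  rw [Finset.sum_map, Matrix.det_succ_column_zero, Finset.sum_smul]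
  refine Finset.sum_congr rfl fun i _ => ?_
  have h' : (τ.erase (τ.orderEmbOfFin h i)).card = n := by
    rw [Finset.card_erase_of_mem (Finset.orderEmbOfFin_mem τ h i), h, Nat.add_sub_cancel]
  rw [Finset.map_orderEmbOfFin_univ τ h]
  simp only [RelEmbedding.coe_toEmbedding, map_smul, card_filter_lt_orderEmbOfFin,
    detCochain_single f h', orderEmbOfFin_erase, smul_smul]
  congr 1
  simp [Matrix.submatrix]

/-- The bordered matrix is singular: either a column vanishes, or the columns of the `f j` add up to
the column of ones and `(1, -1, …, -1)` lies in the kernel. -/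
theorem detCochain_boundary_eq_zero {s : Set (Finset V)}
    (hs : ∀ τ ∈ s, τ.card = n + 1 ∧
      ((∃ j, ∀ x ∈ τ, f j x = 0) ∨ ∀ x ∈ τ, ∑ j, f j x = 1))
    {c : Finset V →₀ G} (hc : c ∈ Finsupp.supported G ℤ s) :
    detCochain G f (boundary G c) = 0 := by
  rw [← Finsupp.sum_single c, Finsupp.sum, map_sum, map_sum]
  refine Finset.sum_eq_zero fun τ hτ => ?_
  obtain ⟨h, hj | h1⟩ := hs τ (hc hτ)
  · obtain ⟨j, hj⟩ := hj
    rw [detCochain_boundary_single f h, Matrix.det_eq_zero_of_column_eq_zero j.succ, zero_smul]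
    intro i
    simpa using hj _ (Finset.orderEmbOfFin_mem τ h i)
  · rw [detCochain_boundary_single f h, Matrix.exists_mulVec_eq_zero_iff.1, zero_smul]
    refine ⟨Fin.cons 1 fun _ => -1, fun h0 => by simpa using congr_fun h0 0, ?_⟩
    ext i
    simp [Matrix.mulVec, dotProduct, Fin.sum_univ_succ,
      h1 _ (Finset.orderEmbOfFin_mem τ h i)]

end Cochain

end PreAbstractSimplicialComplex

/-! ### The coloring of `MS_{d,k}` and the sizes of its color classes. -/

namespace MS

open PreAbstractSimplicialComplex

universe v

variable {d k : ℕ}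

/-- The index of the part containing a vertex: `i` on `S_i`, `k` at `w₁`, and `k + 1` on the rest
of `W`. -/
def color (d k : ℕ) (x : Fin (size d k)) : ℕ :=
  if (x : ℕ) < d then x % k else if (x : ℕ) = d then k else k + 1

theorem color_lt (hk : 1 ≤ k) (x : Fin (size d k)) : color d k x < k + 2 := by
  have := Nat.mod_lt (x : ℕ) hk
  unfold color
  split_ifs <;> omega

theorem color_eq_iff (hk : 1 ≤ k) (x : Fin (size d k)) : color d k x = k ↔ (x : ℕ) = d := by
  have := Nat.mod_lt (x : ℕ) hk
  unfold color
  split_ifs <;> omega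

theorem color_eq_succ_iff (hk : 1 ≤ k) (x : Fin (size d k)) :
    color d k x = k + 1 ↔ d < (x : ℕ) := by
  have := Nat.mod_lt (x : ℕ) hk
  unfold color
  split_ifs <;> omega

theorem color_eq_iff_mem_S (x : Fin (size d k)) (j : Fin k) : color d k x = j ↔ x ∈ S d k j := by
  have := j.isLt
  simp only [color, S, V, Finset.mem_filter, Finset.mem_univ, true_and]
  split_ifs <;> omega

theorem subset_W_union_iff (hk : 1 ≤ k) (σ : Finset (Fin (size d k))) (j : Fin k) :
    σ ⊆ W d k ∪ (Finset.univ.filter (· ≠ j)).biUnion (S d k) ↔ ∀ x ∈ σ, color d k x ≠ j := by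
  refine forall₂_congr fun x _ => ?_
  rw [Ne, color_eq_iff_mem_S]
  simp only [W, S, V, Finset.mem_union, Finset.mem_filter, Finset.mem_univ, true_and,
    Finset.mem_biUnion]
  constructor
  · rintro (h | ⟨i, hi, h1, h2⟩) ⟨h3, h4⟩
    · omega
    · exact hi (Fin.ext (h2.symm.trans h4))
  · intro h
    by_cases hx : (x : ℕ) < d
    · exact Or.inr ⟨⟨x % k, Nat.mod_lt _ hk⟩, fun e => h ⟨hx, congrArg Fin.val e⟩, hx, rfl⟩
    · exact Or.inl (not_lt.1 hx)

theorem subset_erase_w₁_iff (hk : 1 ≤ k) (σ : Finset (Fin (size d k))) :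
    σ ⊆ (V d k ∪ W d k).erase (w₁ d k) ↔ ∀ x ∈ σ, color d k x ≠ k := by
  refine forall₂_congr fun x _ => ?_
  rw [Ne, color_eq_iff hk]
  simp only [V, W, w₁, Finset.mem_erase, Finset.mem_union, Finset.mem_filter, Finset.mem_univ,
    true_and, Ne, Fin.ext_iff]
  omega

theorem subset_insert_w₁_iff (hk : 1 ≤ k) (σ : Finset (Fin (size d k))) :
    σ ⊆ insert (w₁ d k) (V d k) ↔ ∀ x ∈ σ, color d k x ≠ k + 1 := by
  refine forall₂_congr fun x _ => ?_
  rw [Ne, color_eq_succ_iff hk]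
  simp only [V, w₁, Finset.mem_insert, Finset.mem_filter, Finset.mem_univ, true_and, Fin.ext_iff]
  omega

/-- The faces of `MS_{d,k}` are the nonempty sets missing at least one of the `k + 2` colors. -/
theorem mem_faces_iff (hk : 1 ≤ k) (σ : Finset (Fin (size d k))) :
    σ ∈ (complex d k).faces ↔ σ.Nonempty ∧ ∃ c < k + 2, ∀ x ∈ σ, color d k x ≠ c := by
  change (σ.Nonempty ∧ _) ↔ _
  simp only [subset_W_union_iff hk, subset_erase_w₁_iff hk, subset_insert_w₁_iff hk]
  refine and_congr_right fun _ => ⟨?_, ?_⟩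
  · rintro (⟨j, h⟩ | h | h)
    · exact ⟨j, by omega, h⟩
    · exact ⟨k, by omega, h⟩
    · exact ⟨k + 1, by omega, h⟩
  · rintro ⟨c, hc, h⟩
    rcases lt_trichotomy c k with hck | rfl | hck
    · exact Or.inl ⟨⟨c, hck⟩, h⟩
    · exact Or.inr (Or.inl h)
    · obtain rfl : c = k + 1 := by omega
      exact Or.inr (Or.inr h)

theorem card_color_eq_self_le_one (hk : 1 ≤ k) :
    (Finset.univ.filter fun x : Fin (size d k) => color d k x = k).card ≤ 1 := by
  refine Finset.card_le_one.2 fun x hx y hy => ?_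
  rw [Finset.mem_filter, color_eq_iff hk] at hx hy
  exact Fin.ext (hx.2.trans hy.2.symm)

theorem one_le_ceil (hk : 1 ≤ k) (hkd : k ≤ d) : 1 ≤ ⌈(d : ℚ) / k⌉₊ := by
  rw [Nat.one_le_ceil_iff]
  have h1 : (0 : ℚ) < k := by exact_mod_cast hk
  have h2 : (0 : ℚ) < d := by exact_mod_cast hk.trans hkd
  exact div_pos h2 h1

theorem card_color_eq_le (hk : 1 ≤ k) (hkd : k ≤ d) {c : ℕ} (hc : c < k + 2) :
    (Finset.univ.filter fun x : Fin (size d k) => color d k x = c).card ≤ ⌈(d : ℚ) / k⌉₊ := by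
  have hk0 : (0 : ℚ) < k := by exact_mod_cast hk
  rcases lt_trichotomy c k with hck | rfl | hck
  · conv_rhs => rw [← Finset.card_range ⌈(d : ℚ) / k⌉₊]
    have hmem : ∀ x ∈ Finset.univ.filter fun x : Fin (size d k) => color d k x = c,
        (x : ℕ) < d ∧ (x : ℕ) % k = c := by
      intro x hx
      rw [Finset.mem_filter] at hx
      have := hx.2
      unfold color at this
      split_ifs at this with h1 h2
      · exact ⟨h1, this⟩
      · omega
      · omega
    -- Within a residue class modulo `k`, a vertex is determined by its quotient, which is below
    -- `⌈d/k⌉`.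
    refine Finset.card_le_card_of_injOn (fun x => (x : ℕ) / k) ?_ ?_
    · intro x hx
      have hxd : ((x : ℕ) : ℚ) < d := by exact_mod_cast (hmem x hx).1
      rw [Finset.mem_coe, Finset.mem_range, Nat.lt_ceil]
      exact Nat.cast_div_le.trans_lt (div_lt_div_of_pos_right hxd hk0)
    · intro x hx y hy hxy
      have hxy' : (x : ℕ) / k = (y : ℕ) / k := hxy
      refine Fin.ext ?_
      rw [← Nat.div_add_mod (x : ℕ) k, ← Nat.div_add_mod (y : ℕ) k, hxy', (hmem x hx).2,
        (hmem y hy).2]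
  · exact (card_color_eq_self_le_one hk).trans (one_le_ceil hk hkd)
  · obtain rfl : c = k + 1 := by omega
    have h : (Finset.univ.filter fun x : Fin (size d k) => color d k x = k + 1) =
        Finset.Ioi (w₁ d k) := by
      ext x
      rw [Finset.mem_filter, color_eq_succ_iff hk, Finset.mem_Ioi, Fin.lt_def]
      simp [w₁]
    rw [h, Fin.card_Ioi]
    simp only [size, w₁]
    omega

/-! ### Maximal faces and strong connectivity of the skeleton. -/

/-- The largest face missing the color `c`. -/
def facet (d k c : ℕ) : Finset (Fin (size d k)) := Finset.univ.filter fun x => color d k x ≠ c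

theorem mem_facet {c : ℕ} {x : Fin (size d k)} : x ∈ facet d k c ↔ color d k x ≠ c := by
  simp [facet]

theorem mem_faces_of_subset_facet (hk : 1 ≤ k) {c : ℕ} (hc : c < k + 2)
    (σ : Finset (Fin (size d k))) (hσ : σ ⊆ facet d k c) (hne : σ.Nonempty) :
    σ ∈ (complex d k).faces :=
  (mem_faces_iff hk σ).2 ⟨hne, c, hc, fun _ hx => mem_facet.1 (hσ hx)⟩

theorem succ_le_card_facet (hk : 1 ≤ k) (hkd : k ≤ d) {c : ℕ} (hc : c < k + 2) :
    d + 1 ≤ (facet d k c).card := by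
  have h1 := Finset.card_filter_add_card_filter_not (s := Finset.univ)
    fun x : Fin (size d k) => color d k x = c
  have h2 := card_color_eq_le hk hkd hc
  have h3 : size d k = d + 1 + ⌈(d : ℚ) / k⌉₊ := rfl
  rw [Finset.card_univ, Fintype.card_fin] at h1
  have h4 : facet d k c = Finset.univ.filter fun x => ¬ color d k x = c := by
    ext x
    simp [mem_facet]
  rw [h4]
  omega

/-- Only `w₁` has color `k`, so intersecting with the facet that omits it costs at most one of at
least `d + 1` vertices. This makes that facet a suitable center for strong connectivity. -/
theorem le_card_facet_inter (hk : 1 ≤ k) (hkd : k ≤ d) {c : ℕ} (hc : c < k + 2) :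
    d ≤ (facet d k c ∩ facet d k k).card := by
  have h1 := Finset.card_filter_add_card_filter_not (s := facet d k c)
    fun x : Fin (size d k) => color d k x = k
  have h2 := Finset.card_le_card (Finset.filter_subset_filter
    (fun x : Fin (size d k) => color d k x = k) (Finset.subset_univ (facet d k c)))
  have h3 := card_color_eq_self_le_one (d := d) hk
  have h4 := succ_le_card_facet hk hkd hc
  have h5 : facet d k c ∩ facet d k k =
      (facet d k c).filter fun x => ¬ color d k x = k := by
    ext x
    simp [mem_facet]
  rw [h5]
  omega

theorem isStronglyConnected_skeleton_complex (hk : 1 ≤ k) (hkd : k ≤ d) :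
    ((complex d k).skeleton d).IsStronglyConnected d := by
  refine isStronglyConnected_skeleton (B := facet d k k)
    (mem_faces_of_subset_facet hk (by omega)) (succ_le_card_facet hk hkd (by omega)) ?_
  intro σ hσ
  obtain ⟨-, c, hc, h⟩ := (mem_faces_iff hk σ).1 hσ
  exact ⟨facet d k c, fun x hx => mem_facet.2 (h x hx), mem_faces_of_subset_facet hk hc,
    succ_le_card_facet hk hkd hc, le_card_facet_inter hk hkd hc⟩

theorem encard_vertices_skeleton_complex (hk : 1 ≤ k) :
    ((complex d k).skeleton d).vertices.encard = ((d + 1 + ⌈(d : ℚ) / k⌉₊ : ℕ) : ℕ∞) := by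
  have h : ((complex d k).skeleton d).vertices = Set.univ := by
    refine Set.eq_univ_of_forall fun x => ⟨(mem_faces_iff hk _).2 ⟨Finset.singleton_nonempty x, ?_⟩,
      by simp⟩
    by_cases hx : color d k x = 0
    · exact ⟨1, by omega, by simp [hx]⟩
    · exact ⟨0, by omega, by simpa using hx⟩
  rw [h, Set.encard_univ, ENat.card_eq_coe_fintype_card, Fintype.card_fin, size]

/-! ### A nonzero homology class. -/

/-- The vertices `v₁, …, v_k, w₁, w₂`, one of each color. -/
def transversal (hk : 1 ≤ k) (hkd : k ≤ d) : Fin (k + 2) ↪o Fin (size d k) :=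
  OrderEmbedding.ofStrictMono
    (fun i => ⟨if (i : ℕ) < k then i else d + (i - k), by
      have := one_le_ceil hk hkd
      unfold size
      split_ifs <;> omega⟩) (by
    intro i j hij
    rw [Fin.lt_def] at hij ⊢
    dsimp only
    split_ifs <;> omega)

theorem color_transversal (hk : 1 ≤ k) (hkd : k ≤ d) (i : Fin (k + 2)) :
    color d k (transversal hk hkd i) = i := by
  have hv : (transversal hk hkd i : ℕ) = if (i : ℕ) < k then (i : ℕ) else d + (i - k) := rfl
  rw [color, hv]
  split_ifs with h1 h2 h3 <;> first | omega | exact Nat.mod_eq_of_lt h1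

/-- The indicator function of the color `j`. -/
def indicator (d k : ℕ) (j : Fin (k + 1)) (x : Fin (size d k)) : ℤ :=
  if color d k x = j then 1 else 0

variable {G : Type v} [AddCommGroup G]

theorem detCochain_indicator_boundary_eq_zero (hk : 1 ≤ k) {c : Finset (Fin (size d k)) →₀ G}
    (hc : c ∈ ((complex d k).skeleton d).chains G (k + 1)) :
    detCochain G (indicator d k) (boundary G c) = 0 := by
  refine detCochain_boundary_eq_zero _ ?_ hc
  rintro τ ⟨⟨hτ, -⟩, hcard⟩
  refine ⟨hcard, ?_⟩
  obtain ⟨-, c, hc, h⟩ := (mem_faces_iff hk τ).1 hτ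
  -- If the missing color is at most `k`, its indicator vanishes on the face; if it is `k + 1`,
  -- which has no indicator, the indicators sum to one there.
  rcases Nat.lt_or_ge c (k + 1) with hck | hck
  · exact Or.inl ⟨⟨c, hck⟩, fun x hx => if_neg (h x hx)⟩
  · refine Or.inr fun x hx => ?_
    have h1 := color_lt hk x
    have h2 := h x hx
    rw [Finset.sum_eq_single ⟨color d k x, by omega⟩]
    · exact if_pos rfl
    · exact fun j _ hj => if_neg fun e => hj (Fin.ext e.symm)
    · exact fun h' => absurd (Finset.mem_univ _) h'

theorem detCochain_indicator_boundary_transversal (hk : 1 ≤ k) (hkd : k ≤ d) (g : G) :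
    detCochain G (indicator d k) (boundary G (Finsupp.single
      (Finset.univ.map (transversal hk hkd).toEmbedding) g)) = (-1 : ℤ) ^ (k + 1) • g := by
  have hcard : (Finset.univ.map (transversal hk hkd).toEmbedding).card = k + 1 + 1 := by simp
  have horder : ∀ i, (Finset.univ.map (transversal hk hkd).toEmbedding).orderEmbOfFin hcard i =
      transversal hk hkd i := fun i =>
    (congr_fun (Finset.orderEmbOfFin_unique hcard (f := transversal hk hkd)
      (fun i => by simp) (transversal hk hkd).strictMono) i).symm
  -- The last row belongs to `w₂`, whose color has no indicator: only its bordering `1` survives,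
  -- and the complementary minor is the identity.
  rw [detCochain_boundary_single _ hcard, Matrix.det_succ_row _ (Fin.last (k + 1)),
    Finset.sum_eq_single 0]
  · have hsub : (Matrix.of fun i : Fin (k + 1 + 1) => (Fin.cons 1 fun j => indicator d k j
        ((Finset.univ.map (transversal hk hkd).toEmbedding).orderEmbOfFin hcard i) :
          Fin (k + 1 + 1) → ℤ)).submatrix (Fin.last (k + 1)).succAbove (Fin.succAbove 0) = 1 := by
      ext i j
      simp [horder, indicator, color_transversal, Matrix.one_apply, Fin.ext_iff]
    rw [hsub]
    simp
  · intro j _ hj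
    obtain ⟨j, rfl⟩ := Fin.exists_succ_eq.2 hj
    have := j.isLt
    have h : indicator d k j (transversal hk hkd (Fin.last (k + 1))) = 0 := by
      rw [indicator, color_transversal, if_neg]
      simp only [Fin.val_last]
      omega
    simp [horder, h]
  · exact fun h' => absurd (Finset.mem_univ _) h'

theorem boundary_transversal_mem_cycles (hk : 1 ≤ k) (hkd : k ≤ d) (g : G) :
    boundary G (Finsupp.single (Finset.univ.map (transversal hk hkd).toEmbedding) g) ∈
      ((complex d k).skeleton d).cycles G k := by
  rw [cycles, if_neg (by omega)]
  refine ⟨?_, boundary_boundary G _⟩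
  refine boundary_mem_supported (s := {Finset.univ.map (transversal hk hkd).toEmbedding}) ?_
    (Finsupp.single_mem_supported ℤ _ rfl)
  rintro _ rfl x hx
  obtain ⟨i, -, rfl⟩ := Finset.mem_map.1 hx
  have hcard : ((Finset.univ.map (transversal hk hkd).toEmbedding).erase
      ((transversal hk hkd).toEmbedding i)).card = k + 1 := by
    rw [Finset.card_erase_of_mem hx]
    simp
  -- Removing the vertex of color `i` leaves a set that misses that color.
  refine ⟨⟨(mem_faces_iff hk _).2 ⟨Finset.card_pos.1 (by omega), i, i.isLt, ?_⟩, by omega⟩, hcard⟩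
  intro y hy
  obtain ⟨hne, hy⟩ := Finset.mem_erase.1 hy
  obtain ⟨j, -, rfl⟩ := Finset.mem_map.1 hy
  intro h
  refine hne (congrArg _ (Fin.ext ?_))
  rw [← h]
  exact (color_transversal hk hkd j).symm

theorem nontrivial_homology_skeleton_complex [Nontrivial G] (hk : 1 ≤ k) (hkd : k ≤ d) :
    Nontrivial (((complex d k).skeleton d).homology G k) := by
  rw [← not_subsingleton_iff_nontrivial, Submodule.Quotient.subsingleton_iff,
    Submodule.submoduleOf_eq_top]
  intro hle
  obtain ⟨g, hg⟩ := exists_ne (0 : G)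
  obtain ⟨c, hc, hcz⟩ := hle (boundary_transversal_mem_cycles hk hkd g)
  have h := detCochain_indicator_boundary_transversal hk hkd g
  rw [← hcz, detCochain_indicator_boundary_eq_zero hk hc] at h
  rcases neg_one_pow_eq_or ℤ (k + 1) with h' | h' <;> rw [h'] at h
  · exact hg (by simpa using h.symm)
  · exact hg (by simpa using h.symm)

end MS

theorem theorem1p2 (d k : ℕ) (hk : 1 ≤ k) (hkd : k ≤ d) :
    -- the two forms of the bound agree
    d + 1 + ⌈(d : ℚ) / k⌉₊ = ⌈(d * (k + 1) : ℚ) / k + 1⌉₊ ∧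
    -- the lower bound, for every coefficient group
    (∀ (V : Type*) [LinearOrder V] (G : Type*) [AddCommGroup G]
      (X : PreAbstractSimplicialComplex V),
      X.IsStronglyConnected d → Nontrivial (X.homology G k) →
        ((d + 1 + ⌈(d : ℚ) / k⌉₊ : ℕ) : ℕ∞) ≤ X.vertices.encard) ∧
    -- the bound is attained by the `d`-skeleton of `MS_{d,k}`, for every nonzero coefficient group
    (((MS.complex d k).skeleton d).IsStronglyConnected d ∧
      (∀ (G : Type*) [AddCommGroup G] [Nontrivial G],
        Nontrivial (((MS.complex d k).skeleton d).homology G k)) ∧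
      ((MS.complex d k).skeleton d).vertices.encard = ((d + 1 + ⌈(d : ℚ) / k⌉₊ : ℕ) : ℕ∞)) := by
  refine ⟨?_, fun V _ G _ X hX hH => PreAbstractSimplicialComplex.lower_bound hk X hX hH,
    MS.isStronglyConnected_skeleton_complex hk hkd,
    fun G _ _ => MS.nontrivial_homology_skeleton_complex hk hkd,
    MS.encard_vertices_skeleton_complex hk⟩
  have hk0 : (k : ℚ) ≠ 0 := by exact_mod_cast (by omega : k ≠ 0)
  have h : (d * (k + 1) : ℚ) / k + 1 = (d : ℚ) / k + ((d + 1 : ℕ) : ℚ) := by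
    push_cast
    field_simp
    ring
  rw [h, Nat.ceil_add_natCast (by positivity), add_comm]
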